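/- Let $n\ge 1$ and $D\ge 3$ be integers, and equip $(\mathbb R^{n})^{\otimes D}=\mathbb R^{n\times\cdots\times n}$ with the Euclidean (Frobenius) norm. Let $$\mathcal S=\{\alpha\, a^{(1)}\otimes\cdots\otimes a^{(D)} : \alpha\in\mathbb R\setminus\{0\},\ a^{(1)},\dots,a^{(D)}\in\mathbb S^{n-1}\},\qquad \mathcal V=\{\alpha\, a^{\otimes D} : \alpha\in\mathbb R\setminus\{0\},\ a\in\mathbb S^{n-1}\}$$ be the Segre and Veronese manifolds, where $\mathbb S^{n-1}$ is the Euclidean unit sphere of $\mathbb R^n$. For $\mathcal M\in\{\mathcal S,\mathcal V\}$ let $\Sigma:\mathcal M^{\times R}\to\mathbb R^{n\times\cdots\times n}$, $\Sigma(\mathcal A_1,\dots,\mathcal A_R)=\mathcal A_1+\cdots+\mathcal A_R$, be the addition map. For $\mathfrak a=(\mathcal A_1,\dots,\mathcal A_R)\in\mathcal M^{\times R}$ and $\mathcal A=\Sigma(\mathfrak a)$, suppose that $\Sigma$ restricts to a homeomorphism from some neighbourhood $N$ of $\mathfrak a$ in $\mathcal M^{\times R}$ onto $\Sigma(N)$,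 and let $\Sigma_{\mathfrak a}^{-1}:\Sigma(N)\to N$ be its inverse. The condition number of the decomposition $\mathfrak a$ is then $$\kappa_{\mathcal M}(\mathcal A_1,\dots,\mathcal A_R)=\lim_{\delta\to0}\ \sup_{\substack{\widetilde{\mathcal A}\in\Sigma(N)\setminus\{\mathcal A\}\\ \|\mathcal A-\widetilde{\mathcal A}\|\le\delta}}\frac{\|\Sigma_{\mathfrak a}^{-1}(\mathcal A)-\Sigma_{\mathfrak a}^{-1}(\widetilde{\mathcal A})\|}{\|\mathcal A-\widetilde{\mathcal A}\|}\in[0,\infty],$$ where the numerator is measured in the Euclidean norm on $(\mathbb R^{n\times\cdots\times n})^{R}$; this does not depend on the choice of $N$. If there is no such local inverse (in particular, if $\mathfrak a$ is not an isolated point of $\Sigma^{-1}(\mathcal A)$), then $\kappa_{\mathcal M}(\mathcal A_1,\dots,\mathcal A_R)=\infty$. **Proposition.** Let $R\le 2$ and $\mathcal A_1,\dots,\mathcal A_R\in\mathcal V$. Then the condition number of $\mathcal A_1+\dots+\mathcal A_R$ as a Waring decomposition equals its condition number as a canonical polyadic decomposition: $$\kappa_{\mathcal V}(\mathcal A_1,\dots,\mathcal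 A_R)=\kappa_{\mathcal S}(\mathcal A_1,\dots,\mathcal A_R).$$ -/

import Mathlib

open Filter Topology
open scoped ENNReal

noncomputable section

namespace WaringCond

/-- Real tensors of order `D` and format `n × ⋯ × n`, with the Frobenius norm. -/
abbrev Tensor (n D : ℕ) : Type := EuclideanSpace ℝ (Fin D → Fin n)

/-- The tensor product of `D` vectors: its entry at `(i_1, …, i_D)` is `∏ d, (a d)_{i_d}`. -/
def tprod {n D : ℕ} (a : Fin D → EuclideanSpace ℝ (Fin n)) : Tensor n D :=
  WithLp.toLp 2 (fun i => ∏ d, a d (i d))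

/-- The Segre manifold: all `α • (a 1 ⊗ ⋯ ⊗ a D)` with `α ≠ 0` and unit vectors `a d`. -/
def segre (n D : ℕ) : Set (Tensor n D) :=
  {T | ∃ (α : ℝ) (a : Fin D → EuclideanSpace ℝ (Fin n)),
    α ≠ 0 ∧ (∀ d, ‖a d‖ = 1) ∧ T = α • tprod a}

/-- The Veronese manifold: all `α • (a ⊗ ⋯ ⊗ a)` with `α ≠ 0` and a unit vector `a`. -/
def veronese (n D : ℕ) : Set (Tensor n D) :=
  {T | ∃ (α : ℝ) (a : EuclideanSpace ℝ (Fin n)),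
    α ≠ 0 ∧ ‖a‖ = 1 ∧ T = α • tprod (fun _ : Fin D => a)}

section Join

variable {E : Type*} [NormedAddCommGroup E] {R : ℕ}

/-- `R`-tuples of vectors with the Euclidean product norm `(∑ r, ‖b r‖ ^ 2) ^ (1 / 2)`. -/
abbrev Tuple (E : Type*) (R : ℕ) : Type _ := PiLp 2 (fun _ : Fin R => E)

/-- The product `M × ⋯ × M` of `R` copies of `M`. -/
def power (M : Set E) (R : ℕ) : Set (Tuple E R) := {b | ∀ r, b r ∈ M}

/-- The addition map `Σ (b_1, …, b_R) = b_1 + ⋯ + b_R`. -/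
def addMap (b : Tuple E R) : E := ∑ r, b r

/-- `g` is a local inverse at `a` of the addition map `M × ⋯ × M → E`: on some neighbourhood `N`
of `a` in `M × ⋯ × M`, the addition map is a homeomorphism onto its image with inverse `g`. -/
structure IsLocalInverse (M : Set E) (a : Tuple E R) (N : Set (Tuple E R))
    (g : E → Tuple E R) : Prop where
  subset : N ⊆ power M R
  mem_nhdsWithin : N ∈ 𝓝[power M R] a
  left_inv : ∀ b ∈ N, g (addMap b) = b
  continuousOn : ContinuousOn g (addMap '' N)

/-- The limit for `δ → 0` of the supremum of `‖g A - g A'‖ / ‖A - A'‖` over all `A' ≠ A` in the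
domain `Σ N` of the local inverse `g` with `‖A - A'‖ ≤ δ`, where `A = Σ a`. -/
def localCond (a : Tuple E R) (N : Set (Tuple E R)) (g : E → Tuple E R) : ℝ≥0∞ :=
  limsup (fun A' : E => ‖g (addMap a) - g A'‖ₑ / ‖addMap a - A'‖ₑ)
    (𝓝[addMap '' N \ {addMap a}] (addMap a))

/-- The condition number of the decomposition `a` with summands in `M`. All local inverses at `a`
give the same value (`condNumber_eq`), and the infimum is `∞` if there is none; in particular it is
`∞` if `a` is not an isolated decomposition (`condNumber_eq_top`). -/
def condNumber (M : Set E) (a : Tuple E R) : ℝ≥0∞ :=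
  ⨅ (N : Set (Tuple E R)) (g : E → Tuple E R) (_ : IsLocalInverse M a N g), localCond a N g

theorem localCond_le {M : Set E} {a : Tuple E R} (ha : a ∈ power M R)
    {N N' : Set (Tuple E R)} {g g' : E → Tuple E R}
    (h : IsLocalInverse M a N g) (h' : IsLocalInverse M a N' g') :
    localCond a N g ≤ localCond a N' g' := by
  have haN : a ∈ N := mem_of_mem_nhdsWithin ha h.mem_nhdsWithin
  have haN' : a ∈ N' := mem_of_mem_nhdsWithin ha h'.mem_nhdsWithin
  have hga : g (addMap a) = a := h.left_inv a haN
  have hga' : g' (addMap a) = a := h'.left_inv a haN'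
  have hc : Tendsto g (𝓝[addMap '' N] (addMap a)) (𝓝[power M R] a) := by
    refine tendsto_nhdsWithin_iff.2 ⟨?_, ?_⟩
    · have := h.continuousOn (addMap a) ⟨a, haN, rfl⟩
      rwa [ContinuousWithinAt, hga] at this
    · filter_upwards [self_mem_nhdsWithin] with x hx
      obtain ⟨b, hb, rfl⟩ := hx
      rw [h.left_inv b hb]
      exact h.subset hb
  have hev : ∀ᶠ x in 𝓝[addMap '' N] (addMap a), x ∈ addMap '' N' ∧ g' x = g x := by
    filter_upwards [hc h'.mem_nhdsWithin, self_mem_nhdsWithin] with x hx hxN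
    obtain ⟨b, hb, rfl⟩ := hxN
    have hbN' : b ∈ N' := by
      have := h.left_inv b hb
      rw [Set.mem_preimage, this] at hx
      exact hx
    exact ⟨⟨b, hbN', rfl⟩, by rw [h'.left_inv b hbN', h.left_inv b hb]⟩
  have hev2 : ∀ᶠ x in 𝓝[addMap '' N \ {addMap a}] (addMap a),
      x ∈ addMap '' N' ∧ g' x = g x :=
    hev.filter_mono (nhdsWithin_mono _ Set.sdiff_subset)
  have hle : 𝓝[addMap '' N \ {addMap a}] (addMap a)
      ≤ 𝓝[addMap '' N' \ {addMap a}] (addMap a) := by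
    refine le_inf inf_le_left (le_principal_iff.2 ?_)
    filter_upwards [hev2, self_mem_nhdsWithin] with x hx hx2
    exact ⟨hx.1, hx2.2⟩
  calc localCond a N g
      = limsup (fun A' : E => ‖g' (addMap a) - g' A'‖ₑ / ‖addMap a - A'‖ₑ)
          (𝓝[addMap '' N \ {addMap a}] (addMap a)) := by
        refine limsup_congr ?_
        filter_upwards [hev2] with x hx
        rw [hx.2, hga, hga']
    _ ≤ localCond a N' g' := limsup_le_limsup_of_le hle

/-- The condition number can be computed from any local inverse. -/
theorem condNumber_eq {M : Set E} {a : Tuple E R} (ha : a ∈ power M R)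
    {N : Set (Tuple E R)} {g : E → Tuple E R} (h : IsLocalInverse M a N g) :
    condNumber M a = localCond a N g := by
  refine le_antisymm (iInf_le_of_le N (iInf_le_of_le g (iInf_le _ h))) ?_
  exact le_iInf fun N' => le_iInf fun g' => le_iInf fun h' => localCond_le ha h h'

/-- The condition number of a decomposition that is not isolated is `∞`. -/
theorem condNumber_eq_top {M : Set E} {a : Tuple E R} (ha : a ∈ power M R)
    (hiso : ∀ N ∈ 𝓝[power M R] a, ∃ b ∈ N, addMap b = addMap a ∧ b ≠ a) :
    condNumber M a = ⊤ := by
  refine eq_top_iff.2 (le_iInf fun N => le_iInf fun g => le_iInf fun h => ?_)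
  obtain ⟨b, hb, hba, hne⟩ := hiso N h.mem_nhdsWithin
  refine absurd ?_ hne
  rw [← h.left_inv b hb, hba, h.left_inv a (mem_of_mem_nhdsWithin ha h.mem_nhdsWithin)]

end Join

end WaringCond

end

/-! Since the Veronese manifold V lies in the Segre manifold S, a local inverse for S restricts to
one for V, so κ_V ≤ κ_S. For the converse, a bound K on κ_V forces ∑‖s_r‖² ≤ K²‖∑ s_r‖² for tangent
vectors s_r of V (`sum_norm_sq_le_of_hasDerivAt`). The same inequality on the tangent spaces of S
gives κ_S ≤ K (`condNumber_le_of_forall_hasStrictFDerivAt`). What remains is linear algebra: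
`sum_norm_tang_sq_le`.

Tangent vectors of S at a multiple of a^{⊗D} are the `tang a w`. Splitting w into its mean over the
D slots and the deviations writes them as a tangent vector of V plus a `tang a m` with ∑ m_d = 0.
The two kinds are orthogonal even at different base points, so the deviation part can be estimated
alone. For two summands, with c = ⟪a, b⟫, cosines between deviation parts are at most |c|^(D-2) in
absolute value (`norm_add_tang_sq_ge`), while the tangent spaces of V already attain a cosine at
least that large (`one_le_mul_of_forall_tang_const`). Hence the Veronese part is always the worse
conditioned one. -/

namespace WaringCond

/-! ### Condition numbers and inequalities for tangent vectors -/

section Join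

variable {E : Type*} [NormedAddCommGroup E] {R : ℕ}

theorem condNumber_mono {M M' : Set E} (hM : M ⊆ M') (a : Tuple E R) :
    condNumber M a ≤ condNumber M' a := by
  have hp : power M R ⊆ power M' R := fun b hb r => hM (hb r)
  refine le_iInf fun N => le_iInf fun g => le_iInf fun h =>
    iInf_le_of_le (N ∩ power M R) (iInf_le_of_le g (iInf_le_of_le ⟨?_, ?_, ?_, ?_⟩ ?_))
  · exact Set.inter_subset_right
  · exact inter_mem (nhdsWithin_mono _ hp h.mem_nhdsWithin) self_mem_nhdsWithin
  · exact fun b hb => h.left_inv b hb.1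
  · exact h.continuousOn.mono (Set.image_mono Set.inter_subset_left)
  · exact limsup_le_limsup_of_le (nhdsWithin_mono _
      (Set.sdiff_subset_sdiff_left (Set.image_mono Set.inter_subset_left)))

/-- If the addition map is locally expanding by at least `1 / K`, then the condition number is at
most `K`. -/
theorem condNumber_le_of_eventually {M : Set E} {a : Tuple E R} (ha : a ∈ power M R) {K : NNReal}
    (h : ∀ᶠ p : Tuple E R × Tuple E R in 𝓝[power M R] a ×ˢ 𝓝[power M R] a,
      ‖p.1 - p.2‖ ≤ K * ‖addMap p.1 - addMap p.2‖) :
    condNumber M a ≤ K := by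
  obtain ⟨N, hN, h⟩ := (eventually_prod_self_iff' (la := 𝓝[power M R] a)
    (r := fun p => ‖p.1 - p.2‖ ≤ K * ‖addMap p.1 - addMap p.2‖)).1 h
  set N' := N ∩ power M R
  have hN' : N' ∈ 𝓝[power M R] a := inter_mem hN self_mem_nhdsWithin
  have hinj : Set.InjOn (addMap : Tuple E R → E) N' := by
    intro x hx y hy hxy
    have := h x hx.1 y hy.1
    simp only [hxy, sub_self, norm_zero, mul_zero] at this
    exact sub_eq_zero.1 (norm_le_zero_iff.1 this)
  have hl : ∀ b ∈ N', Function.invFunOn addMap N' (addMap b) = b := fun b hb =>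
    hinj.leftInvOn_invFunOn hb
  have hinv : IsLocalInverse M a N' (Function.invFunOn addMap N') := by
    refine ⟨Set.inter_subset_right, hN', hl, ?_⟩
    refine LipschitzOnWith.continuousOn (K := K) (LipschitzOnWith.of_dist_le_mul ?_)
    rintro _ ⟨x, hx, rfl⟩ _ ⟨y, hy, rfl⟩
    rw [hl x hx, hl y hy, dist_eq_norm, dist_eq_norm]
    exact h x hx.1 y hy.1
  refine iInf_le_of_le N' (iInf_le_of_le _ (iInf_le_of_le hinv ?_))
  refine limsup_le_of_le (by isBoundedDefault) ?_
  filter_upwards [self_mem_nhdsWithin] with x hx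
  obtain ⟨⟨b, hb, rfl⟩, -⟩ := hx
  have haN := mem_of_mem_nhdsWithin ha hN'
  rw [hl a haN, hl b hb]
  refine ENNReal.div_le_of_le_mul ?_
  rw [enorm_eq_nnnorm, enorm_eq_nnnorm]
  exact_mod_cast h a haN.1 b hb.1

variable [NormedSpace ℝ E]

/-- The addition map as a continuous linear map. -/
noncomputable def addCLM (E : Type*) [NormedAddCommGroup E] [NormedSpace ℝ E] (R : ℕ) :
    Tuple E R →L[ℝ] E := ∑ r, PiLp.proj 2 (fun _ : Fin R => E) r

theorem addCLM_apply (b : Tuple E R) : addCLM E R b = addMap b := by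
  simp [addCLM, addMap]

/-- A bound for the condition number bounds the distance to nearby decompositions. -/
theorem eventually_norm_sub_le {M : Set E} {a : Tuple E R} (ha : a ∈ power M R) {K : NNReal}
    (hK : condNumber M a < K) :
    ∀ᶠ b in 𝓝[power M R] a, ‖a - b‖ ≤ K * ‖addMap a - addMap b‖ := by
  simp only [condNumber, iInf_lt_iff] at hK
  obtain ⟨N, g, h, hK⟩ := hK
  have haN : a ∈ N := mem_of_mem_nhdsWithin ha h.mem_nhdsWithin
  have hev := eventually_lt_of_limsup_lt hK
  rw [eventually_nhdsWithin_iff] at hev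
  have hc : Tendsto (fun b : Tuple E R => addMap b) (𝓝[power M R] a) (𝓝 (addMap a)) := by
    simp only [← addCLM_apply]
    exact ((addCLM E R).continuous.tendsto a).mono_left nhdsWithin_le_nhds
  filter_upwards [hc.eventually hev, h.mem_nhdsWithin] with b hb hbN
  -- The supremum omits the point `addMap a` itself; there injectivity on `N` gives `b = a`.
  by_cases hab : addMap b = addMap a
  · have : b = a := by rw [← h.left_inv b hbN, hab, h.left_inv a haN]
    simp [this]
  · have hlt := hb ⟨⟨b, hbN, rfl⟩, hab⟩
    rw [h.left_inv b hbN, h.left_inv a haN] at hlt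
    have hne : ‖addMap a - addMap b‖ₑ ≠ 0 := by
      simpa [sub_eq_zero] using fun h => hab h.symm
    have hle := (ENNReal.div_le_iff hne (by simp)).1 hlt.le
    rw [enorm_eq_nnnorm, enorm_eq_nnnorm] at hle
    exact_mod_cast hle

/-- A bound for the condition number bounds velocities of curves of decompositions. -/
theorem norm_le_of_hasDerivAt {M : Set E} {a : Tuple E R} (ha : a ∈ power M R) {K : NNReal}
    (hK : condNumber M a ≤ K) {γ : ℝ → Tuple E R} {s : Tuple E R} (hγ : HasDerivAt γ s 0)
    (h0 : γ 0 = a) (hM : ∀ᶠ τ in 𝓝 0, γ τ ∈ power M R) :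
    ‖s‖ ≤ K * ‖addMap s‖ := by
  -- A strict bound is needed to get an eventual estimate out of the limsup; `K'` tends to `K` at
  -- the end.
  have key : ∀ K' : NNReal, K < K' → ‖s‖ ≤ K' * ‖addMap s‖ := by
    intro K' hKK'
    have hev := eventually_norm_sub_le ha (hK.trans_lt (ENNReal.coe_lt_coe.2 hKK'))
    have hγ' : HasDerivAt (fun τ => addCLM E R (γ τ)) (addCLM E R s) 0 :=
      (addCLM E R).hasFDerivAt.comp_hasDerivAt 0 hγ
    have ht : Tendsto γ (𝓝[≠] 0) (𝓝[power M R] a) := by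
      refine tendsto_nhdsWithin_iff.2 ⟨?_, hM.filter_mono nhdsWithin_le_nhds⟩
      rw [← h0]
      exact hγ.continuousAt.tendsto.mono_left nhdsWithin_le_nhds
    have h1 := (hasDerivAt_iff_tendsto_slope.1 hγ).norm
    have h2 := (hasDerivAt_iff_tendsto_slope.1 hγ').norm.const_mul (K' : ℝ)
    rw [← addCLM_apply]
    refine le_of_tendsto_of_tendsto h1 h2 ?_
    filter_upwards [ht.eventually hev] with τ hτ
    simp only [slope_def_module, norm_smul, h0]
    rw [norm_sub_rev (γ τ), norm_sub_rev (addCLM E R (γ τ)), addCLM_apply, addCLM_apply]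
    nlinarith [norm_nonneg ((τ - 0)⁻¹)]
  have hlim : Tendsto (fun x : NNReal => (x : ℝ) * ‖addMap s‖) (𝓝[>] K)
      (𝓝 (K * ‖addMap s‖)) :=
    ((NNReal.continuous_coe.tendsto K).mul_const _).mono_left nhdsWithin_le_nhds
  exact ge_of_tendsto hlim (by filter_upwards [self_mem_nhdsWithin] with x hx using key x hx)

/-- An upper bound for the condition number from a differentiable map which fixes `M × ⋯ × M` near
`a`, and on the range of whose derivative the addition map is expanding. -/
theorem condNumber_le_of_hasStrictFDerivAt {M : Set E} {a : Tuple E R} (ha : a ∈ power M R)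
    {K : NNReal} {Φ : Tuple E R → Tuple E R} {P : Tuple E R →L[ℝ] Tuple E R}
    (hΦ : HasStrictFDerivAt Φ P a) (hfix : ∀ᶠ b in 𝓝[power M R] a, Φ b = b)
    (hP : ∀ h, ‖P h‖ ≤ K * ‖addMap (P h)‖) : condNumber M a ≤ K := by
  refine le_of_forall_gt_imp_ge_of_dense fun c hc => ?_
  rcases eq_or_ne c ⊤ with rfl | hct
  · exact le_top
  lift c to NNReal using hct
  have hKc : (K : ℝ) < c := by exact_mod_cast hc
  refine condNumber_le_of_eventually ha ?_
  set C : ℝ := K * ‖addCLM E R‖ + 1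
  have hC : 0 < C := by positivity
  have hc0 : (0 : ℝ) < c := lt_of_le_of_lt K.2 hKc
  -- Chosen so that c(1 - εC) = (c + K)/2, which is at least K and positive.
  set ε : ℝ := (c - K) / (2 * (c * C))
  have hε : 0 < ε := div_pos (sub_pos.2 hKc) (by positivity)
  have hεC : ε * C * c = (c - K) / 2 := by
    simp only [ε]; field_simp
  have hle : 𝓝[power M R] a ×ˢ 𝓝[power M R] a ≤ 𝓝 (a, a) := by
    rw [nhds_prod_eq]
    exact prod_mono nhdsWithin_le_nhds nhdsWithin_le_nhds
  have hsmall := (hΦ.isLittleO.def hε).filter_mono hle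
  filter_upwards [hsmall, hfix.prod_mk hfix] with p hp hq
  -- Both points are fixed by `Φ`, so the linearisation error bounds `h - P h` itself.
  rw [hq.1, hq.2] at hp
  rw [← addCLM_apply, ← addCLM_apply, ← map_sub]
  set h := p.1 - p.2
  have h1 : ‖h‖ ≤ ‖P h‖ + ‖h - P h‖ := by
    simpa using norm_add_le (P h) (h - P h)
  have h2 : ‖addCLM E R (P h)‖ ≤ ‖addCLM E R h‖ + ‖addCLM E R‖ * (ε * ‖h‖) := by
    have e : addCLM E R (P h) = addCLM E R h - addCLM E R (h - P h) := by simp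
    rw [e]
    refine (norm_sub_le _ _).trans (add_le_add le_rfl ?_)
    exact ((addCLM E R).le_opNorm _).trans (mul_le_mul_of_nonneg_left hp (norm_nonneg _))
  have h3 : ‖P h‖ ≤ K * (‖addCLM E R h‖ + ‖addCLM E R‖ * (ε * ‖h‖)) := by
    refine (hP h).trans ?_
    rw [← addCLM_apply]
    exact mul_le_mul_of_nonneg_left h2 K.2
  have h4 : ‖h‖ * (1 - ε * C) ≤ K * ‖addCLM E R h‖ := by
    simp only [C]; nlinarith
  have h5 : ‖h‖ * ((c + K) / 2) ≤ c * (K * ‖addCLM E R h‖) := by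
    have : c * (‖h‖ * (1 - ε * C)) = ‖h‖ * ((c + K) / 2) := by linear_combination (-‖h‖) * hεC
    exact this ▸ mul_le_mul_of_nonneg_left h4 hc0.le
  have h6 : (K : ℝ) * ‖addCLM E R h‖ ≤ (c + K) / 2 * ‖addCLM E R h‖ :=
    mul_le_mul_of_nonneg_right (by linarith) (norm_nonneg _)
  have hK0 : (0 : ℝ) ≤ K := K.2
  have hpos : (0 : ℝ) < (c + K) / 2 := by linarith
  refine le_of_mul_le_mul_left ?_ hpos
  nlinarith

theorem hasDerivAt_tuple {γ : ℝ → Tuple E R} {s : Tuple E R} {t : ℝ}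
    (h : ∀ r, HasDerivAt (fun τ => γ τ r) (s r) t) : HasDerivAt γ s t :=
  (PiLp.continuousLinearEquiv 2 ℝ (fun _ : Fin R => E)).symm.hasFDerivAt.comp_hasDerivAt t
    (hasDerivAt_pi.2 h)

/-- A bound for the condition number bounds the norms of tuples of tangent vectors, given as
velocities of curves in `M`. -/
theorem sum_norm_sq_le_of_hasDerivAt {M : Set E} {a : Tuple E R} (ha : a ∈ power M R) {K : NNReal}
    (hK : condNumber M a ≤ K) {γ : Fin R → ℝ → E} {s : Fin R → E}
    (hγ : ∀ r, HasDerivAt (γ r) (s r) 0) (h0 : ∀ r, γ r 0 = a r)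
    (hM : ∀ r, ∀ᶠ τ in 𝓝 0, γ r τ ∈ M) :
    ∑ r, ‖s r‖ ^ 2 ≤ (K : ℝ) ^ 2 * ‖∑ r, s r‖ ^ 2 := by
  have h := norm_le_of_hasDerivAt ha hK (γ := fun τ => WithLp.toLp 2 fun r => γ r τ)
    (s := WithLp.toLp 2 s) (hasDerivAt_tuple hγ) (by ext1 r; exact h0 r) (eventually_all.2 hM)
  have h2 := pow_le_pow_left₀ (norm_nonneg _) h 2
  rwa [mul_pow, PiLp.norm_sq_eq_of_L2] at h2

/-- An upper bound for the condition number from differentiable maps which fix `M` near the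
summands, and on the ranges of whose derivatives the addition map is expanding. -/
theorem condNumber_le_of_forall_hasStrictFDerivAt {M : Set E} {a : Tuple E R} (ha : a ∈ power M R)
    {K : NNReal} {Φ : Fin R → E → E} {P : Fin R → E →L[ℝ] E}
    (hΦ : ∀ r, HasStrictFDerivAt (Φ r) (P r) (a r))
    (hfix : ∀ r, ∀ᶠ b in 𝓝 (a r), b ∈ M → Φ r b = b)
    (hP : ∀ h : Fin R → E, ∑ r, ‖P r (h r)‖ ^ 2 ≤ (K : ℝ) ^ 2 * ‖∑ r, P r (h r)‖ ^ 2) :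
    condNumber M a ≤ K := by
  refine condNumber_le_of_hasStrictFDerivAt ha
    (Φ := fun b => WithLp.toLp 2 fun r => Φ r (b r))
    (P := (PiLp.continuousLinearEquiv 2 ℝ (fun _ : Fin R => E)).symm.toContinuousLinearMap ∘L
      ContinuousLinearMap.pi fun r => P r ∘L PiLp.proj 2 (fun _ : Fin R => E) r) ?_ ?_ ?_
  · exact (hasStrictFDerivAt_piLp 2).2 fun r =>
      (hΦ r).comp a (PiLp.hasStrictFDerivAt_apply (𝕜 := ℝ) 2 a r)
  · have h1 : ∀ r, ∀ᶠ b : Tuple E R in 𝓝 a, b r ∈ M → Φ r (b r) = b r := fun r =>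
      ((PiLp.proj 2 (𝕜 := ℝ) (fun _ : Fin R => E) r).continuous.tendsto a).eventually (hfix r)
    filter_upwards [self_mem_nhdsWithin,
      (eventually_all.2 h1).filter_mono nhdsWithin_le_nhds] with b hb hne
    ext1 r
    exact hne r (hb r)
  · intro h
    refine (sq_le_sq₀ (norm_nonneg _) (by positivity)).1 ?_
    rw [mul_pow, PiLp.norm_sq_eq_of_L2]
    exact hP h

end Join

open scoped RealInnerProductSpace

/-- The derivative `∑ d, a ⊗ ⋯ ⊗ w d ⊗ ⋯ ⊗ a` of the tensor product at `(a, …, a)`. -/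
noncomputable def tang {n D : ℕ} (a : EuclideanSpace ℝ (Fin n))
    (w : Fin D → EuclideanSpace ℝ (Fin n)) : Tensor n D :=
  ∑ d, tprod (Function.update (fun _ => a) d (w d))

/-! ### Inner products of tangent vectors, and the passage from Veronese to Segre -/

section LinearAlgebra

variable {n D : ℕ}

theorem tprod_apply (x : Fin D → EuclideanSpace ℝ (Fin n)) (i : Fin D → Fin n) :
    tprod x i = ∏ d, x d (i d) := rfl

theorem tprod_update_apply (a w : EuclideanSpace ℝ (Fin n)) (d : Fin D) (i : Fin D → Fin n) :
    tprod (Function.update (fun _ => a) d w) i = (∏ e ∈ Finset.univ.erase d, a (i e)) * w (i d) := by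
  rw [tprod_apply, ← Finset.prod_erase_mul _ _ (Finset.mem_univ d), Function.update_self]
  congr 1
  exact Finset.prod_congr rfl fun e he => by rw [Function.update_of_ne (Finset.ne_of_mem_erase he)]

theorem tang_apply (a : EuclideanSpace ℝ (Fin n)) (w : Fin D → EuclideanSpace ℝ (Fin n))
    (i : Fin D → Fin n) :
    tang a w i = ∑ d, (∏ e ∈ Finset.univ.erase d, a (i e)) * w d (i d) := by
  simp [tang, tprod_update_apply]

theorem tang_add (a : EuclideanSpace ℝ (Fin n)) (w v : Fin D → EuclideanSpace ℝ (Fin n)) :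
    tang a (fun d => w d + v d) = tang a w + tang a v := by
  ext i
  simp [tang_apply, mul_add, Finset.sum_add_distrib]

theorem tang_smul (a : EuclideanSpace ℝ (Fin n)) (c : ℝ) (w : Fin D → EuclideanSpace ℝ (Fin n)) :
    tang a (fun d => c • w d) = c • tang a w := by
  ext i
  simp [tang_apply, Finset.mul_sum, mul_left_comm]

theorem inner_tprod (x y : Fin D → EuclideanSpace ℝ (Fin n)) :
    ⟪tprod x, tprod y⟫ = ∏ d, ⟪x d, y d⟫ := by
  simp only [PiLp.inner_apply, tprod_apply]
  rw [Finset.prod_univ_sum]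
  simp [Finset.prod_mul_distrib]

theorem inner_tprod_update_self (a b w v : EuclideanSpace ℝ (Fin n)) (d : Fin D) :
    ⟪tprod (Function.update (fun _ => a) d w), tprod (Function.update (fun _ => b) d v)⟫ =
      ⟪a, b⟫ ^ (D - 1) * ⟪w, v⟫ := by
  rw [inner_tprod, ← Finset.prod_erase_mul _ _ (Finset.mem_univ d), Function.update_self,
    Function.update_self]
  congr 1
  rw [Finset.prod_congr rfl (g := fun _ => ⟪a, b⟫)]
  · simp
  · intro e he
    rw [Function.update_of_ne (Finset.ne_of_mem_erase he),
      Function.update_of_ne (Finset.ne_of_mem_erase he)]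

theorem inner_tprod_update_of_ne (a b w v : EuclideanSpace ℝ (Fin n)) {d e : Fin D} (h : d ≠ e) :
    ⟪tprod (Function.update (fun _ => a) d w), tprod (Function.update (fun _ => b) e v)⟫ =
      ⟪a, b⟫ ^ (D - 2) * (⟪w, b⟫ * ⟪a, v⟫) := by
  have he : e ∈ Finset.univ.erase d := by simp [h.symm]
  rw [inner_tprod, ← Finset.prod_erase_mul _ _ (Finset.mem_univ d),
    ← Finset.prod_erase_mul _ _ he, Function.update_self, Function.update_self,
    Function.update_of_ne h, Function.update_of_ne h.symm,
    Finset.prod_congr rfl (g := fun _ => ⟪a, b⟫)]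
  · rw [Finset.prod_const, Finset.card_erase_of_mem he, Finset.card_erase_of_mem (Finset.mem_univ d),
      Finset.card_univ, Fintype.card_fin, Nat.sub_sub]
    ring
  · intro f hf
    simp only [Finset.mem_erase] at hf
    rw [Function.update_of_ne hf.1, Function.update_of_ne hf.2.1]

/-- Pairs of distinct slots contribute a product of two sums; the subtracted sum removes the
diagonal from that product. -/
theorem inner_tang (a b : EuclideanSpace ℝ (Fin n)) (w v : Fin D → EuclideanSpace ℝ (Fin n)) :
    ⟪tang a w, tang b v⟫ = ⟪a, b⟫ ^ (D - 1) * ∑ d, ⟪w d, v d⟫ +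
      ⟪a, b⟫ ^ (D - 2) * (⟪∑ d, w d, b⟫ * ⟪a, ∑ d, v d⟫ - ∑ d, ⟪w d, b⟫ * ⟪a, v d⟫) := by
  have h : ∀ d e, ⟪tprod (Function.update (fun _ => a) d (w d)),
      tprod (Function.update (fun _ => b) e (v e))⟫ =
      ⟪a, b⟫ ^ (D - 2) * (⟪w d, b⟫ * ⟪a, v e⟫) + if d = e then
        ⟪a, b⟫ ^ (D - 1) * ⟪w d, v d⟫ - ⟪a, b⟫ ^ (D - 2) * (⟪w d, b⟫ * ⟪a, v d⟫) else 0 := by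
    intro d e
    split_ifs with hde
    · subst hde
      rw [inner_tprod_update_self]; ring
    · rw [inner_tprod_update_of_ne _ _ _ _ hde, add_zero]
  rw [tang, tang, sum_inner, Finset.sum_congr rfl fun d _ => inner_sum _ _ _]
  simp only [h, Finset.sum_add_distrib, Finset.sum_ite_eq, Finset.mem_univ, if_true,
    Finset.sum_sub_distrib, ← Finset.mul_sum, sum_inner, inner_sum, ← Finset.sum_mul]
  ring

theorem inner_tang_const (hD : 2 ≤ D) (a b w v : EuclideanSpace ℝ (Fin n)) :
    ⟪tang a (fun _ : Fin D => w), tang b (fun _ : Fin D => v)⟫ =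
      D * ⟪a, b⟫ ^ (D - 2) * (⟪a, b⟫ * ⟪w, v⟫ + (D - 1) * (⟪w, b⟫ * ⟪a, v⟫)) := by
  obtain ⟨k, rfl⟩ := Nat.exists_eq_add_of_le hD
  have h1 : 2 + k - 1 = k + 1 := by omega
  have h2 : 2 + k - 2 = k := by omega
  simp [inner_tang, h1, h2, ← Nat.cast_smul_eq_nsmul ℝ, inner_smul_left, inner_smul_right]
  ring

/-- The left tensor is symmetric, so the pairing depends on `v` only through ∑ v_d. -/
theorem inner_tang_const_of_sum_eq_zero (a b w : EuclideanSpace ℝ (Fin n))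
    {v : Fin D → EuclideanSpace ℝ (Fin n)} (hv : ∑ d, v d = 0) :
    ⟪tang a (fun _ : Fin D => w), tang b v⟫ = 0 := by
  rw [inner_tang, ← inner_sum, ← Finset.mul_sum, ← inner_sum, hv]
  simp

/-- The Cauchy–Schwarz inequality for the bivectors `a ∧ x` and `b ∧ y`. -/
theorem two_mul_abs_le_of_norm_eq_one {a b : EuclideanSpace ℝ (Fin n)} (ha : ‖a‖ = 1) (hb : ‖b‖ = 1)
    (x y : EuclideanSpace ℝ (Fin n)) :
    2 * |⟪a, b⟫ * ⟪x, y⟫ - ⟪x, b⟫ * ⟪a, y⟫| ≤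
      (⟪x, x⟫ - ⟪x, a⟫ * ⟪a, x⟫) + (⟪y, y⟫ - ⟪y, b⟫ * ⟪b, y⟫) := by
  have haa : ⟪a, a⟫ = 1 := by rw [real_inner_self_eq_norm_sq, ha]; norm_num
  have hbb : ⟪b, b⟫ = 1 := by rw [real_inner_self_eq_norm_sq, hb]; norm_num
  -- For s = ±1 this is the sum of squares of the entries of a ∧ x + s (b ∧ y), each pair of indices
  -- being counted twice.
  have key : ∀ s : ℝ, s ^ 2 = 1 → 0 ≤ 2 * ((⟪x, x⟫ - ⟪x, a⟫ * ⟪a, x⟫) +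
      (⟪y, y⟫ - ⟪y, b⟫ * ⟪b, y⟫) + s * (2 * (⟪a, b⟫ * ⟪x, y⟫ - ⟪x, b⟫ * ⟪a, y⟫))) := by
    intro s hs
    have e : ∑ i, ∑ j, ((a i * x j - a j * x i) + s * (b i * y j - b j * y i)) ^ 2 =
        2 * ((⟪a, a⟫ * ⟪x, x⟫ - ⟪x, a⟫ * ⟪a, x⟫) + s ^ 2 * (⟪b, b⟫ * ⟪y, y⟫ - ⟪y, b⟫ * ⟪b, y⟫) +
          s * (2 * (⟪a, b⟫ * ⟪x, y⟫ - ⟪x, b⟫ * ⟪a, y⟫))) := by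
      have e1 : ∀ u v p q : EuclideanSpace ℝ (Fin n),
          ⟪u, v⟫ * ⟪p, q⟫ = ∑ i, ∑ j, (u i * v i) * (p j * q j) := by
        intro u v p q
        simp only [PiLp.inner_apply, Finset.sum_mul_sum]
        simp [mul_comm]
      have e2 : ∀ u v p q : EuclideanSpace ℝ (Fin n),
          ⟪u, v⟫ * ⟪p, q⟫ = ∑ i, ∑ j, (u j * v j) * (p i * q i) := by
        intro u v p q
        rw [e1, Finset.sum_comm]
      have e3 : 2 * ((⟪a, a⟫ * ⟪x, x⟫ - ⟪x, a⟫ * ⟪a, x⟫) +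
          s ^ 2 * (⟪b, b⟫ * ⟪y, y⟫ - ⟪y, b⟫ * ⟪b, y⟫) +
          s * (2 * (⟪a, b⟫ * ⟪x, y⟫ - ⟪x, b⟫ * ⟪a, y⟫))) =
          (⟪a, a⟫ * ⟪x, x⟫ + ⟪a, a⟫ * ⟪x, x⟫ - 2 * (⟪x, a⟫ * ⟪a, x⟫)) +
          s ^ 2 * (⟪b, b⟫ * ⟪y, y⟫ + ⟪b, b⟫ * ⟪y, y⟫ - 2 * (⟪y, b⟫ * ⟪b, y⟫)) +
          2 * s * (⟪a, b⟫ * ⟪x, y⟫ + ⟪a, b⟫ * ⟪x, y⟫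
            - ⟪x, b⟫ * ⟪a, y⟫ - ⟪x, b⟫ * ⟪a, y⟫) := by ring
      rw [e3]
      nth_rewrite 1 [e1 a a, e1 b b, e1 a b, e1 x b]
      rw [e2 a a, e2 b b, e2 a b, e2 x b, e1 x a, e1 y b]
      simp only [Finset.mul_sum, ← Finset.sum_add_distrib, ← Finset.sum_sub_distrib]
      refine Finset.sum_congr rfl fun i _ => Finset.sum_congr rfl fun j _ => ?_
      ring
    rw [haa, hbb, hs, one_mul, one_mul, one_mul] at e
    rw [← e]
    positivity
  have h1 := key 1 (by norm_num)
  have h2 := key (-1) (by norm_num)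
  have h3 : |⟪a, b⟫ * ⟪x, y⟫ - ⟪x, b⟫ * ⟪a, y⟫| ≤
      ((⟪x, x⟫ - ⟪x, a⟫ * ⟪a, x⟫) + (⟪y, y⟫ - ⟪y, b⟫ * ⟪b, y⟫)) / 2 := by
    rw [abs_le]
    constructor <;> linarith
  linarith

/-- With vanishing sums, `inner_tang` reduces to bivectors slot by slot: ‖tang a w‖² = ∑‖a ∧ w_d‖²,
and the mixed inner product is ⟪a, b⟫^(D-2) ∑⟪a ∧ w_d, b ∧ v_d⟫. Cauchy–Schwarz applies in each
slot. -/
theorem norm_add_tang_sq_ge (hD : 2 ≤ D) {a b : EuclideanSpace ℝ (Fin n)} (ha : ‖a‖ = 1)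
    (hb : ‖b‖ = 1) {w v : Fin D → EuclideanSpace ℝ (Fin n)} (hw : ∑ d, w d = 0)
    (hv : ∑ d, v d = 0) :
    (1 - |⟪a, b⟫| ^ (D - 2)) * (‖tang a w‖ ^ 2 + ‖tang b v‖ ^ 2) ≤ ‖tang a w + tang b v‖ ^ 2 := by
  obtain ⟨k, rfl⟩ := Nat.exists_eq_add_of_le hD
  have h1 : 2 + k - 1 = k + 1 := by omega
  have h2 : 2 + k - 2 = k := by omega
  have haa : ⟪a, a⟫ = 1 := by rw [real_inner_self_eq_norm_sq, ha]; norm_num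
  have hbb : ⟪b, b⟫ = 1 := by rw [real_inner_self_eq_norm_sq, hb]; norm_num
  have hG : ⟪tang a w, tang b v⟫ =
      ⟪a, b⟫ ^ k * ∑ d, (⟪a, b⟫ * ⟪w d, v d⟫ - ⟪w d, b⟫ * ⟪a, v d⟫) := by
    rw [inner_tang, hw, hv, h1, h2, Finset.sum_sub_distrib, ← Finset.mul_sum]
    simp
    ring
  have hN : ∀ (c : EuclideanSpace ℝ (Fin n)), ⟪c, c⟫ = 1 →
      ∀ u : Fin (2 + k) → EuclideanSpace ℝ (Fin n), ∑ d, u d = 0 →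
      ‖tang c u‖ ^ 2 = ∑ d, (⟪u d, u d⟫ - ⟪u d, c⟫ * ⟪c, u d⟫) := by
    intro c hc u hu
    rw [← real_inner_self_eq_norm_sq, inner_tang, hc, hu, Finset.sum_sub_distrib]
    simp [sub_eq_add_neg]
  have hle : 2 * |⟪tang a w, tang b v⟫| ≤
      |⟪a, b⟫| ^ k * (‖tang a w‖ ^ 2 + ‖tang b v‖ ^ 2) := by
    rw [hG, abs_mul, abs_pow, hN a haa w hw, hN b hbb v hv, ← Finset.sum_add_distrib,
      mul_left_comm]
    refine mul_le_mul_of_nonneg_left ?_ (by positivity)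
    refine (mul_le_mul_of_nonneg_left (Finset.abs_sum_le_sum_abs _ _) (by norm_num)).trans ?_
    rw [Finset.mul_sum]
    exact Finset.sum_le_sum fun d _ => two_mul_abs_le_of_norm_eq_one ha hb _ _
  rw [norm_add_sq_real, h2]
  have := neg_abs_le ⟪tang a w, tang b v⟫
  nlinarith

/-- Here -u is the projection of s onto the line of u, so the angle between s and -u has cosine
‖u‖/‖s‖ ≥ p. -/
theorem one_le_mul_of_inner_eq {E : Type*} [NormedAddCommGroup E] [InnerProductSpace ℝ E]
    {s u : E} {L p : ℝ} (hp : 0 ≤ p) (hs : s ≠ 0) (hu : ⟪s, u⟫ = -‖u‖ ^ 2)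
    (hpu : p ^ 2 * ‖s‖ ^ 2 ≤ ‖u‖ ^ 2)
    (h : ∀ x y : ℝ, ‖x • s‖ ^ 2 + ‖y • u‖ ^ 2 ≤ L * ‖x • s + y • u‖ ^ 2) :
    1 ≤ L * (1 - p) := by
  have hs0 : 0 < ‖s‖ ^ 2 := by positivity
  have hL : 1 ≤ L := by
    have := h 1 0
    simp only [one_smul, zero_smul, norm_zero, add_zero] at this
    nlinarith
  rcases hp.eq_or_lt with rfl | hp
  · simpa using hL
  -- The weight p makes the two norms equal in the extreme case ‖u‖ = p‖s‖.
  have h1 := h p 1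
  rw [norm_add_sq_real, norm_smul, norm_smul, inner_smul_left, inner_smul_right, hu] at h1
  simp only [Real.norm_eq_abs, mul_pow, sq_abs, one_pow, one_mul, RCLike.conj_to_real] at h1
  have hu0 : 0 < ‖u‖ ^ 2 := lt_of_lt_of_le (by positivity) hpu
  have h2 : (L - 1) * (p ^ 2 * ‖s‖ ^ 2) ≤ (L - 1) * ‖u‖ ^ 2 :=
    mul_le_mul_of_nonneg_left hpu (by linarith)
  have h3 : 0 ≤ (L * (1 - p) - 1) * ‖u‖ ^ 2 := by nlinarith
  nlinarith [nonneg_of_mul_nonneg_left h3 hu0]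

/-- A tangent vector s at a is paired with u, minus its orthogonal projection onto the Veronese
tangent space at b. The choice of s depends on whether (D-1)c² ≥ 1. -/
theorem one_le_mul_of_forall_tang_const (hD : 3 ≤ D) {a b : EuclideanSpace ℝ (Fin n)}
    (ha : ‖a‖ = 1) (hb : ‖b‖ = 1) {L : ℝ}
    (h : ∀ w v : EuclideanSpace ℝ (Fin n),
      ‖tang a (fun _ : Fin D => w)‖ ^ 2 + ‖tang b (fun _ : Fin D => v)‖ ^ 2 ≤
        L * ‖tang a (fun _ : Fin D => w) + tang b (fun _ : Fin D => v)‖ ^ 2) :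
    1 ≤ L * (1 - |⟪a, b⟫| ^ (D - 2)) := by
  have haa : ⟪a, a⟫ = 1 := by rw [real_inner_self_eq_norm_sq, ha]; norm_num
  have hbb : ⟪b, b⟫ = 1 := by rw [real_inner_self_eq_norm_sq, hb]; norm_num
  have hba : ⟪b, a⟫ = ⟪a, b⟫ := real_inner_comm _ _
  have hD2 : 2 ≤ D := by omega
  have hDr : (3 : ℝ) ≤ D := by exact_mod_cast hD
  have hc1 : ⟪a, b⟫ ^ 2 ≤ 1 := by
    have := abs_real_inner_le_norm a b
    rw [ha, hb, one_mul] at this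
    exact (sq_le_one_iff_abs_le_one _).2 this
  have aux : ∀ w v : EuclideanSpace ℝ (Fin n), tang a (fun _ : Fin D => w) ≠ 0 →
      ⟪tang a (fun _ : Fin D => w), tang b (fun _ : Fin D => v)⟫ =
        -‖tang b (fun _ : Fin D => v)‖ ^ 2 →
      (|⟪a, b⟫| ^ (D - 2)) ^ 2 * ‖tang a (fun _ : Fin D => w)‖ ^ 2 ≤
        ‖tang b (fun _ : Fin D => v)‖ ^ 2 → 1 ≤ L * (1 - |⟪a, b⟫| ^ (D - 2)) := by
    intro w v h1 h2 h3
    refine one_le_mul_of_inner_eq (by positivity) h1 h2 h3 fun x y => ?_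
    rw [← tang_smul, ← tang_smul]
    exact h _ _
  have hsq : (|⟪a, b⟫| ^ (D - 2)) ^ 2 = (⟪a, b⟫ ^ (D - 2)) ^ 2 := by
    rw [← abs_pow, sq_abs]
  set c := ⟪a, b⟫
  set q := c ^ (D - 2)
  have ev : ∀ x y : ℝ, ⟪x • a + y • b, x • a + y • b⟫ = x ^ 2 + 2 * x * y * c + y ^ 2 := by
    intro x y
    simp only [inner_add_left, inner_add_right, inner_smul_left, inner_smul_right,
      RCLike.conj_to_real, haa, hbb, hba]
    ring
  have ea : ∀ x y : ℝ, ⟪a, x • a + y • b⟫ = x + y * c := by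
    intro x y
    simp only [inner_add_right, inner_smul_right, haa]
    ring
  have eb : ∀ x y : ℝ, ⟪b, x • a + y • b⟫ = x * c + y := by
    intro x y
    simp only [inner_add_right, inner_smul_right, hbb, hba]
    ring
  have ea' : ∀ x y : ℝ, ⟪x • a + y • b, a⟫ = x + y * c := fun x y => by
    rw [real_inner_comm, ea]
  have eb' : ∀ x y : ℝ, ⟪x • a + y • b, b⟫ = x * c + y := fun x y => by
    rw [real_inner_comm, eb]
  have hw : ∀ x y : ℝ, ‖tang a (fun _ : Fin D => x • a + y • b)‖ ^ 2 =
      D * ((x ^ 2 + 2 * x * y * c + y ^ 2) + (D - 1) * (x + y * c) ^ 2) := by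
    intro x y
    rw [← real_inner_self_eq_norm_sq, inner_tang_const hD2, haa, ev, ea, ea']
    ring
  have hv : ∀ x y : ℝ, ‖tang b (fun _ : Fin D => x • a + y • b)‖ ^ 2 =
      D * ((x ^ 2 + 2 * x * y * c + y ^ 2) + (D - 1) * (x * c + y) ^ 2) := by
    intro x y
    rw [← real_inner_self_eq_norm_sq, inner_tang_const hD2, hbb, ev, eb, eb']
    ring
  have hwv : ∀ x y x' y' : ℝ, ⟪tang a (fun _ : Fin D => x • a + y • b),
      tang b (fun _ : Fin D => x' • a + y' • b)⟫ =
      D * q * (c * (x * (x' + y' * c) + y * (x' * c + y')) +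
        (D - 1) * ((x * c + y) * (x' + y' * c))) := by
    intro x y x' y'
    rw [inner_tang_const hD2, inner_add_left, inner_smul_left, inner_smul_left, ea, eb, eb']
    simp [q, c]
  have hne : ∀ x y : ℝ, 0 < ‖tang a (fun _ : Fin D => x • a + y • b)‖ ^ 2 →
      tang a (fun _ : Fin D => x • a + y • b) ≠ 0 := by
    intro x y hpos h0
    simp [h0] at hpos
  generalize (D : ℝ) = δ at *
  by_cases ht : (δ - 1) * (1 - c ^ 2) ≤ δ - 2
  · refine aux ((1 : ℝ) • a + (0 : ℝ) • b) ((-(q * c * δ)) • a + (q * c * (δ - 1) * c) • b)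
      (hne _ _ ?_) ?_ ?_
    · rw [hw]
      nlinarith
    · rw [hwv, hv]
      ring
    · rw [hw, hv, hsq]
      have h1 : 0 ≤ (δ * q) ^ 2 * ((1 - c ^ 2) * ((δ - 2) - (δ - 1) * (1 - c ^ 2))) :=
        mul_nonneg (sq_nonneg _) (mul_nonneg (by linarith) (by linarith))
      linear_combination h1
  · have ht0 : 0 < 1 - c ^ 2 := by
      by_contra hcon
      nlinarith
    -- Direction w = b - ca, orthogonal to a, with v again from the projection condition. The norm
    -- bound needs (D-1)(1-c²) ≥ 1, which the case assumption gives because D - 2 ≥ 1.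
    refine aux ((-c) • a + (1 : ℝ) • b)
      ((-(q * ((δ - 1) * (1 - c ^ 2) - c ^ 2))) • a +
        (c * (q * ((δ - 1) * (1 - c ^ 2) - c ^ 2)) - q * c * (1 - c ^ 2)) • b)
      (hne _ _ ?_) ?_ ?_
    · rw [hw]
      have : 0 < δ * (1 - c ^ 2) := mul_pos (by linarith) ht0
      linear_combination this
    · rw [hwv, hv]
      ring
    · rw [hw, hv, hsq]
      have h1 : 0 ≤ δ * (1 - c ^ 2) * q ^ 2 * (δ * (1 - c ^ 2) * ((δ - 1) * (1 - c ^ 2) - 1)) := by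
        have : 0 ≤ δ * (1 - c ^ 2) := mul_nonneg (by linarith) ht0.le
        exact mul_nonneg (mul_nonneg this (sq_nonneg _)) (mul_nonneg this (by linarith))
      linear_combination h1

/-- For at most two summands, a lower bound for the addition map on the tangent spaces of the
Veronese manifold extends to the tangent spaces of the Segre manifold. -/
theorem sum_norm_tang_sq_le (hD : 3 ≤ D) {R : ℕ} (hR : R ≤ 2)
    {a : Fin R → EuclideanSpace ℝ (Fin n)} (ha : ∀ r, ‖a r‖ = 1) {L : ℝ}
    (h : ∀ w : Fin R → EuclideanSpace ℝ (Fin n),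
      ∑ r, ‖tang (a r) (fun _ : Fin D => w r)‖ ^ 2 ≤
        L * ‖∑ r, tang (a r) (fun _ : Fin D => w r)‖ ^ 2)
    (w : Fin R → Fin D → EuclideanSpace ℝ (Fin n)) :
    ∑ r, ‖tang (a r) (w r)‖ ^ 2 ≤ L * ‖∑ r, tang (a r) (w r)‖ ^ 2 := by
  have hD0 : (D : ℝ) ≠ 0 := by
    have : D ≠ 0 := by omega
    exact_mod_cast this
  set u : Fin R → EuclideanSpace ℝ (Fin n) := fun r => (D : ℝ)⁻¹ • ∑ d, w r d
  set m : Fin R → Fin D → EuclideanSpace ℝ (Fin n) := fun r d => w r d - u r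
  have hm : ∀ r, ∑ d, m r d = 0 := by
    intro r
    simp [m, u, Finset.sum_sub_distrib, ← Nat.cast_smul_eq_nsmul ℝ, smul_smul, hD0]
  have hdec : ∀ r, tang (a r) (w r) = tang (a r) (fun _ : Fin D => u r) + tang (a r) (m r) := by
    intro r
    rw [← tang_add]
    simp [m]
  have horth : ∀ r r', ⟪tang (a r) (fun _ : Fin D => u r), tang (a r') (m r')⟫ = 0 :=
    fun r r' => inner_tang_const_of_sum_eq_zero _ _ _ (hm r')
  have e1 : ∀ r, ‖tang (a r) (w r)‖ ^ 2 =
      ‖tang (a r) (fun _ : Fin D => u r)‖ ^ 2 + ‖tang (a r) (m r)‖ ^ 2 := by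
    intro r
    rw [hdec, norm_add_sq_real, horth]
    ring
  have e2 : ‖∑ r, tang (a r) (w r)‖ ^ 2 =
      ‖∑ r, tang (a r) (fun _ : Fin D => u r)‖ ^ 2 + ‖∑ r, tang (a r) (m r)‖ ^ 2 := by
    have h0 : ⟪∑ r, tang (a r) (fun _ : Fin D => u r), ∑ r, tang (a r) (m r)⟫ = 0 := by
      rw [sum_inner]
      refine Finset.sum_eq_zero fun r _ => ?_
      rw [inner_sum]
      exact Finset.sum_eq_zero fun r' _ => horth r r'
    simp only [hdec, Finset.sum_add_distrib]
    rw [norm_add_sq_real, h0]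
    ring
  have hmean : ∑ r, ‖tang (a r) (m r)‖ ^ 2 ≤ L * ‖∑ r, tang (a r) (m r)‖ ^ 2 := by
    clear_value m u
    interval_cases R
    · simp
    -- For one summand L ≥ 1 suffices, and any nonzero Veronese tangent vector yields it.
    · have hself : 0 < ‖tang (a 0) (fun _ : Fin D => a 0)‖ ^ 2 := by
        rw [← real_inner_self_eq_norm_sq, inner_tang_const (by omega),
          real_inner_self_eq_norm_sq, ha]
        have : (0 : ℝ) < D := by positivity
        norm_num
        positivity
      have h1 := h fun _ => a 0
      simp only [Fin.sum_univ_one] at h1 ⊢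
      have hL : 1 ≤ L := by nlinarith
      nlinarith [sq_nonneg ‖tang (a 0) (m 0)‖]
    · simp only [Fin.sum_univ_two] at h ⊢
      have hL := one_le_mul_of_forall_tang_const hD (ha 0) (ha 1) (L := L) fun x y => by
        simpa using h ![x, y]
      have h1 := norm_add_tang_sq_ge (by omega) (ha 0) (ha 1) (hm 0) (hm 1)
      have hc1 : |⟪a 0, a 1⟫| ^ (D - 2) ≤ 1 := by
        refine pow_le_one₀ (abs_nonneg _) ?_
        simpa [ha] using abs_real_inner_le_norm (a 0) (a 1)
      have hL0 : 0 ≤ L := by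
        by_contra hneg
        nlinarith
      have h2 := mul_le_mul_of_nonneg_left h1 hL0
      have h3 : 0 ≤ ‖tang (a 0) (m 0)‖ ^ 2 + ‖tang (a 1) (m 1)‖ ^ 2 := by positivity
      nlinarith
  rw [e2, mul_add, Finset.sum_congr rfl fun r _ => e1 r, Finset.sum_add_distrib]
  exact add_le_add (h u) hmean

end LinearAlgebra

/-! ### Veronese curves and a smooth map fixing the Segre manifold locally -/

section Geometry

variable {n D : ℕ}

theorem veronese_subset_segre : veronese n D ⊆ segre n D := by
  rintro _ ⟨α, a, hα, ha, rfl⟩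
  exact ⟨α, fun _ => a, hα, fun _ => ha, rfl⟩

theorem smul_tprod_mem_veronese {α : ℝ} (hα : α ≠ 0) {x : EuclideanSpace ℝ (Fin n)} (hx : x ≠ 0) :
    α • tprod (fun _ : Fin D => x) ∈ veronese n D := by
  have hx0 : ‖x‖ ≠ 0 := norm_ne_zero_iff.2 hx
  refine ⟨α * ‖x‖ ^ D, ‖x‖⁻¹ • x, mul_ne_zero hα (pow_ne_zero _ hx0), ?_, ?_⟩
  · rw [norm_smul, norm_inv, norm_norm, inv_mul_cancel₀ hx0]
  · ext i
    simp [tprod_apply, Finset.prod_mul_distrib]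
    field_simp

theorem hasDerivAt_tprod_add_smul (a v : EuclideanSpace ℝ (Fin n)) :
    HasDerivAt (fun τ : ℝ => tprod (fun _ : Fin D => a + τ • v)) (tang a fun _ => v) 0 := by
  refine (PiLp.continuousLinearEquiv 2 ℝ
    (fun _ : Fin D → Fin n => ℝ)).symm.hasFDerivAt.comp_hasDerivAt (0 : ℝ)
    (f' := (tang a fun _ => v).ofLp) (hasDerivAt_pi.2 fun i => ?_)
  have h1 : ∀ d ∈ Finset.univ, HasDerivAt (fun τ : ℝ => a (i d) + τ * v (i d)) (v (i d)) 0 := by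
    intro d _
    simpa using ((hasDerivAt_id (0 : ℝ)).mul_const (v (i d))).const_add (a (i d))
  have h2 := HasDerivAt.fun_finsetProd h1
  simp only [smul_eq_mul, zero_mul, add_zero] at h2
  rw [tang_apply]
  exact h2

/-- The linear form `B ↦ ⟪a ⊗ ⋯ ⊗ e_j ⊗ ⋯ ⊗ a, B⟫`, with `e_j` in position `d`. -/
noncomputable def contr (a : EuclideanSpace ℝ (Fin n)) (d : Fin D) (j : Fin n) :
    Tensor n D →L[ℝ] ℝ :=
  innerSL ℝ (tprod (Function.update (fun _ => a) d (EuclideanSpace.single j 1)))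

/-- The linear form `B ↦ ⟪a ⊗ ⋯ ⊗ a, B⟫`. -/
noncomputable def evalForm (D : ℕ) (a : EuclideanSpace ℝ (Fin n)) : Tensor n D →L[ℝ] ℝ :=
  innerSL ℝ (tprod fun _ => a)

/-- A rational map which fixes the rank-one tensors not orthogonal to `a ⊗ ⋯ ⊗ a`. -/
noncomputable def rankOneMap (a : EuclideanSpace ℝ (Fin n)) (B : Tensor n D) : Tensor n D :=
  WithLp.toLp 2 fun i => (evalForm D a B ^ (D - 1))⁻¹ * ∏ d, contr a d (i d) B

theorem evalForm_smul_tprod (a : EuclideanSpace ℝ (Fin n)) (γ : ℝ)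
    (b : Fin D → EuclideanSpace ℝ (Fin n)) :
    evalForm D a (γ • tprod b) = γ * ∏ d, ⟪a, b d⟫ := by
  simp [evalForm, inner_tprod]

theorem contr_smul_tprod (a : EuclideanSpace ℝ (Fin n)) (d : Fin D) (j : Fin n) (γ : ℝ)
    (b : Fin D → EuclideanSpace ℝ (Fin n)) :
    contr a d j (γ • tprod b) = γ * ((∏ e ∈ Finset.univ.erase d, ⟪a, b e⟫) * b d j) := by
  rw [contr, innerSL_apply_apply, inner_smul_right, inner_tprod,
    ← Finset.prod_erase_mul _ _ (Finset.mem_univ d), Function.update_self]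
  congr 2
  · exact Finset.prod_congr rfl fun e he => by
      rw [Function.update_of_ne (Finset.ne_of_mem_erase he)]
  · rw [EuclideanSpace.inner_single_left]
    simp

/-- For B = γ ⊗ b_d, contracting all slots but d with a gives a multiple of b_d. The product of
these is (γ∏⟪a, b_e⟫)^(D-1) B, and the scalar is divided out. -/
theorem rankOneMap_eq_self (hD : 1 ≤ D) {a : EuclideanSpace ℝ (Fin n)} {B : Tensor n D}
    (hB : B ∈ segre n D) (h : evalForm D a B ≠ 0) : rankOneMap a B = B := by
  obtain ⟨γ, b, hγ, -, rfl⟩ := hB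
  rw [evalForm_smul_tprod] at h
  have hZ : ∏ d, ⟪a, b d⟫ ≠ 0 := right_ne_zero_of_mul h
  have hz : ∀ d, ⟪a, b d⟫ ≠ 0 := fun d => Finset.prod_ne_zero_iff.1 hZ d (Finset.mem_univ d)
  obtain ⟨k, rfl⟩ := Nat.exists_eq_add_of_le' hD
  have hprod : ∀ d, ∏ e ∈ Finset.univ.erase d, ⟪a, b e⟫ = (∏ e, ⟪a, b e⟫) / ⟪a, b d⟫ := by
    intro d
    rw [eq_div_iff (hz d), Finset.prod_erase_mul _ _ (Finset.mem_univ d)]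
  ext i
  simp only [rankOneMap, evalForm_smul_tprod, contr_smul_tprod, hprod, Finset.prod_mul_distrib,
    Finset.prod_div_distrib, Finset.prod_const, Finset.card_univ, Fintype.card_fin,
    PiLp.smul_apply, tprod_apply, smul_eq_mul, Nat.add_sub_cancel]
  field_simp
  rw [mul_pow]
  ring

theorem exists_hasStrictFDerivAt_rankOneMap (hD : 1 ≤ D) {a : EuclideanSpace ℝ (Fin n)}
    (ha : ‖a‖ = 1) {α : ℝ} (hα : α ≠ 0) :
    ∃ P : Tensor n D →L[ℝ] Tensor n D,
      HasStrictFDerivAt (rankOneMap a) P (α • tprod fun _ => a) ∧ ∀ h, ∃ w, P h = tang a w := by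
  have haa : ⟪a, a⟫ = 1 := by rw [real_inner_self_eq_norm_sq, ha]; norm_num
  set A : Tensor n D := α • tprod fun _ => a
  have hA : evalForm D a A = α := by
    rw [evalForm_smul_tprod]
    simp [ha]
  have hc : ∀ (d : Fin D) j, contr a d j A = α * a j := by
    intro d j
    rw [contr_smul_tprod]
    simp [ha]
  have hg' : HasStrictDerivAt (fun x : ℝ => (x ^ (D - 1))⁻¹)
      (deriv (fun x : ℝ => (x ^ (D - 1))⁻¹) α) (evalForm D a A) := by
    rw [hA]
    have : ContDiffAt ℝ 1 (fun x : ℝ => (x ^ (D - 1))⁻¹) α :=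
      (contDiffAt_id.pow _).inv (pow_ne_zero _ hα)
    exact this.hasStrictDerivAt (by norm_num)
  have h1 := hg'.comp_hasStrictFDerivAt A (evalForm D a).hasStrictFDerivAt
  have h2 : ∀ i : Fin D → Fin n, HasStrictFDerivAt (fun B : Tensor n D => ∏ d, contr a d (i d) B)
      (∑ d, (∏ e ∈ Finset.univ.erase d, contr a e (i e) A) • contr a d (i d)) A := fun i =>
    HasStrictFDerivAt.finsetProd fun d _ => (contr a d (i d)).hasStrictFDerivAt
  set Q : (Fin D → Fin n) → Tensor n D →L[ℝ] ℝ := fun i =>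
    (evalForm D a A ^ (D - 1))⁻¹ •
      ∑ d, (∏ e ∈ Finset.univ.erase d, contr a e (i e) A) • contr a d (i d) +
    (∏ d, contr a d (i d) A) • deriv (fun x : ℝ => (x ^ (D - 1))⁻¹) α • evalForm D a
  have h3 : ∀ i, HasStrictFDerivAt (fun B => rankOneMap a B i) (Q i) A := fun i => h1.mul (h2 i)
  refine ⟨(PiLp.continuousLinearEquiv 2 ℝ (fun _ : Fin D → Fin n => ℝ)).symm.toContinuousLinearMap ∘L
    ContinuousLinearMap.pi Q, (hasStrictFDerivAt_piLp 2).2 fun i => h3 i, fun h => ?_⟩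
  set ℓ : ℝ := deriv (fun x : ℝ => (x ^ (D - 1))⁻¹) α * evalForm D a h
  have hD0 : (D : ℝ) ≠ 0 := by
    have : D ≠ 0 := by omega
    exact_mod_cast this
  -- Differentiating the scalar prefactor produces a multiple of a^{⊗D}, which is shared equally
  -- among the D slots.
  refine ⟨fun d => WithLp.toLp 2 fun j => contr a d j h + ℓ * α ^ D / D * a j, ?_⟩
  ext i
  have hpow : (α ^ (D - 1))⁻¹ * α ^ (D - 1) = 1 := inv_mul_cancel₀ (pow_ne_zero _ hα)
  have hmul : ∀ d : Fin D, (∏ e ∈ Finset.univ.erase d, a (i e)) * a (i d) = ∏ e, a (i e) :=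
    fun d => Finset.prod_erase_mul _ _ (Finset.mem_univ d)
  have hR : tang a (fun d => WithLp.toLp 2 fun j => contr a d j h + ℓ * α ^ D / D * a j) i =
      ∑ d, (∏ e ∈ Finset.univ.erase d, a (i e)) * contr a d (i d) h + ℓ * α ^ D * ∏ e, a (i e) := by
    have : ∀ d : Fin D, (∏ e ∈ Finset.univ.erase d, a (i e)) *
        (contr a d (i d) h + ℓ * α ^ D / D * a (i d)) =
        (∏ e ∈ Finset.univ.erase d, a (i e)) * contr a d (i d) h +
          ℓ * α ^ D / D * ∏ e, a (i e) := by
      intro d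
      rw [← hmul d]; ring
    rw [tang_apply]
    simp only [this, Finset.sum_add_distrib]
    simp
    field_simp
  rw [hR]
  simp [Q, hA, hc, Finset.prod_mul_distrib, ℓ]
  simp only [mul_assoc, ← Finset.mul_sum]
  rw [← mul_assoc, hpow]
  ring

end Geometry

/-! ### Comparison of the two condition numbers -/

theorem condNumber_segre_le {n D R : ℕ} (hD : 3 ≤ D) (hR : R ≤ 2) {a : Tuple (Tensor n D) R}
    (ha : ∀ r, a r ∈ veronese n D) {K : NNReal} (hK : condNumber (veronese n D) a ≤ K) :
    condNumber (segre n D) a ≤ K := by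
  choose α x hα hx hax using ha
  have haV : a ∈ power (veronese n D) R := fun r => ⟨α r, x r, hα r, hx r, hax r⟩
  have hV : ∀ w : Fin R → EuclideanSpace ℝ (Fin n),
      ∑ r, ‖tang (x r) (fun _ : Fin D => w r)‖ ^ 2 ≤
        (K : ℝ) ^ 2 * ‖∑ r, tang (x r) (fun _ : Fin D => w r)‖ ^ 2 := by
    intro w
    refine sum_norm_sq_le_of_hasDerivAt haV hK
      -- The factor `(α r)⁻¹` makes the velocity exactly `tang (x r) (fun _ => w r)`.
      (γ := fun r τ => α r • tprod (fun _ : Fin D => x r + τ • ((α r)⁻¹ • w r))) ?_ ?_ ?_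
    · intro r
      have h1 := (hasDerivAt_tprod_add_smul (D := D) (x r) ((α r)⁻¹ • w r)).const_smul (α r)
      rw [← tang_smul, smul_inv_smul₀ (hα r)] at h1
      exact h1
    · intro r
      simp [hax r]
    · intro r
      have hcont : Continuous fun τ : ℝ => x r + τ • ((α r)⁻¹ • w r) := by fun_prop
      have hne : x r + (0 : ℝ) • ((α r)⁻¹ • w r) ≠ 0 := by
        rw [zero_smul, add_zero, ← norm_ne_zero_iff, hx r]
        exact one_ne_zero
      filter_upwards [hcont.continuousAt.eventually_ne hne] with τ hτ
      exact smul_tprod_mem_veronese (hα r) hτ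
  have hS := sum_norm_tang_sq_le hD hR hx hV
  choose P hP hPt using fun r => exists_hasStrictFDerivAt_rankOneMap (D := D) (by omega) (hx r) (hα r)
  refine condNumber_le_of_forall_hasStrictFDerivAt (fun r => veronese_subset_segre (haV r))
    (Φ := fun r => rankOneMap (x r)) (P := P) ?_ ?_ ?_
  · intro r
    rw [hax r]
    exact hP r
  · intro r
    have hne : evalForm D (x r) (a r) ≠ 0 := by
      rw [hax r, evalForm_smul_tprod]
      simp [hα r, hx r]
    filter_upwards [(evalForm D (x r)).continuous.continuousAt.eventually_ne hne] with b hb hbS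
    exact rankOneMap_eq_self (by omega) hbS hb
  · intro h
    choose w hw using fun r => hPt r (h r)
    simp only [hw]
    exact hS w

end WaringCond

theorem proposition1 (n D R : ℕ) (hD : 3 ≤ D) (hR : R ≤ 2)
    (a : WaringCond.Tuple (WaringCond.Tensor n D) R)
    (ha : ∀ r, a r ∈ WaringCond.veronese n D) :
    WaringCond.condNumber (WaringCond.veronese n D) a =
      WaringCond.condNumber (WaringCond.segre n D) a := by
  refine le_antisymm (WaringCond.condNumber_mono WaringCond.veronese_subset_segre a) ?_
  rcases eq_or_ne (WaringCond.condNumber (WaringCond.veronese n D) a) ⊤ with h | h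
  · rw [h]
    exact le_top
  · rw [← ENNReal.coe_toNNReal h]
    exact WaringCond.condNumber_segre_le hD hR ha (ENNReal.coe_toNNReal h).ge
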